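/- For $n\ge 0$ and a permutation $\tau=\tau(1)\cdots\tau(n)\in\mathfrak S_n$, write $|\tau|=n$. For an integer $m\ge 1$, let $\mathfrak S^{(m)}$ be the set of permutations $\tau$ (of all lengths $n\ge 0$) that avoid the pattern $12\cdots m(m+1)$, that is, in which every ascending subsequence $\tau(i_1)<\cdots<\tau(i_k)$ with $i_1<\cdots<i_k$ has length $k\le m$. Then, as formal power series in $t$ with rational coefficients, $$\sum_{\tau\in\mathfrak S^{(m)}}\frac{t^{2|\tau|}}{|\tau|!^2}=\det\left(I_{i-j}\right)_{1\le i,j\le m},$$ where, for every integer $i$, $$I_i=\sum_{n\ge\max(0,-i)}\frac{t^{2n+i}}{n!\,(n+i)!}.$$ -/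

import Mathlib

open scoped Nat PowerSeries.WithPiTopology

/-- The permutations of all finite lengths: a pair of a length `n` and an element of `𝔖ₙ`. -/
abbrev FinPerm : Type := Σ n : ℕ, Equiv.Perm (Fin n)

/-- The length `|τ|` of a permutation. -/
def FinPerm.length (τ : FinPerm) : ℕ := τ.1

/-- `τ` has an ascending subsequence of length `k`: there are positions `i₁ < ⋯ < iₖ` with
`τ(i₁) < ⋯ < τ(iₖ)`. -/
def FinPerm.HasAscending (τ : FinPerm) (k : ℕ) : Prop :=
  ∃ f : Fin k → Fin τ.1, StrictMono f ∧ StrictMono fun j => τ.2 (f j)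

/-- `𝔖⁽ᵐ⁾`: the permutations all of whose ascending subsequences have length at most `m`, that is,
those that avoid the pattern `12⋯m(m+1)`. -/
def increasingAvoiders (m : ℕ) : Set FinPerm :=
  {τ | ∀ k : ℕ, τ.HasAscending k → k ≤ m}

/-- The formal power series `Iᵢ = ∑_{n ≥ max(0, -i)} t^(2n+i) / (n! (n+i)!)`, for `i ∈ ℤ`.
The coefficient of `t^k` collects the pairs `(n, n+i)` of natural numbers with
`n + (n+i) = k`. -/
def besselI (i : ℤ) : PowerSeries ℚ :=
  PowerSeries.mk fun k =>
    ∑ p ∈ Finset.HasAntidiagonal.antidiagonal k with (p.2 : ℤ) = (p.1 : ℤ) + i, 1 / ((p.1 ! : ℚ) * (p.2 ! : ℚ))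

/-- `besselI i` is the sum of the terms `t^(2n+i) / (n! (n+i)!)` over `n ≥ max(0, -i)`. -/
theorem hasSum_besselI (i : ℤ) :
    HasSum (fun n : {n : ℕ // max 0 (-i) ≤ (n : ℤ)} =>
        PowerSeries.monomial (2 * (n : ℤ) + i).toNat
          (1 / (((n : ℕ) ! : ℚ) * (((n : ℤ) + i).toNat ! : ℚ))))
      (besselI i) := by
  rw [PowerSeries.WithPiTopology.hasSum_iff_hasSum_coeff]
  intro k
  simp only [besselI, PowerSeries.coeff_mk, PowerSeries.coeff_monomial]
  by_cases h : ∃ n : {n : ℕ // max 0 (-i) ≤ (n : ℤ)}, k = (2 * (n : ℤ) + i).toNat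
  · obtain ⟨⟨n, hn⟩, hk⟩ := h
    simp only at hk
    have e : (Finset.HasAntidiagonal.antidiagonal k).filter (fun p => (p.2 : ℤ) = (p.1 : ℤ) + i)
        = {(n, ((n : ℤ) + i).toNat)} := by
      ext ⟨a, b⟩
      simp only [Finset.mem_filter, Finset.HasAntidiagonal.mem_antidiagonal, Finset.mem_singleton, Prod.mk.injEq]
      omega
    rw [e, Finset.sum_singleton]
    convert hasSum_single (⟨n, hn⟩ : {n : ℕ // max 0 (-i) ≤ (n : ℤ)}) ?_ using 1
    · simp [hk]
    · rintro ⟨n', hn'⟩ hne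
      rw [if_neg]
      intro hk'
      apply hne
      simp only [Subtype.mk.injEq]
      simp only at hk'
      omega
  · push Not at h
    have e : (Finset.HasAntidiagonal.antidiagonal k).filter (fun p => (p.2 : ℤ) = (p.1 : ℤ) + i) = ∅ := by
      ext ⟨a, b⟩
      simp only [Finset.mem_filter, Finset.HasAntidiagonal.mem_antidiagonal, Finset.notMem_empty, iff_false]
      rintro ⟨h1, h2⟩
      refine h ⟨a, by omega⟩ ?_
      simp only
      omega
    rw [e, Finset.sum_empty]
    convert hasSum_zero using 1
    funext n
    exact if_neg (h n)

/-!
Both sides satisfy the same recursion in a set of patience-sorting thresholds.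

Read a word in the letters `0, 1, …` from left to right and let `z j` be one more than the smallest
last letter of an increasing subsequence of length `j + 1`. A new letter `s` replaces the unique
`z j` with `z (j - 1) ≤ s < z j` by `s + 1`; if there is none, an increasing subsequence of length
`m + 1` appears. Hence, if the letter `s` has weight `x s`, the generating function `W (z)` (in
`T ^ n / n!`) of the words that can be read from the thresholds `z` satisfies
`dW (z) / dT = ∑ j, ∑ s ∈ [z (j - 1), z j), x s * W (z with z j replaced by s + 1)`
(`wordSum_succ`).

When all `x s ^ 2` vanish, this equation is solved by `det (φ (i - j) (z j))`, where
`φ r (y) = ∑ k, T ^ k / k! * E y ^ (k + r) / (k + r)!` and `E y = ∑ s < y, x s`. Indeed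
`∂φ r / ∂T = φ (r + 1)`, so differentiating the determinant raises the index of one column at a
time, while `φ (r + 1) (s + 1) - φ (r + 1) (s) = x s * φ r (s + 1)`, so the inner sum over `s`
telescopes to the same determinant minus one with a repeated or zero column
(`derivative_det_thresholdMatrix`). At `T = 0` the matrix is unitriangular.

With `n` letters and all thresholds equal to `n`, the words of length `n` without repeated letters
are the permutations, each of weight `∏ s < n, x s`. The determinant is homogeneous, so that its
coefficient of `T ^ n` is `c n * (E n) ^ n = c n * n! * ∏ s < n, x s`, where `c n` is the
coefficient of `t ^ (2 n)` in the determinant of Bessel series (`det_besselI`). Comparison in the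
polynomial ring modulo the squares of the variables gives `c n = #avoiders / n! ^ 2`.
-/

/-! ### Longest increasing subsequences of words -/

/-- The greatest length of a strictly increasing subsequence of the word `w` all of whose letters
are at least `b`. The recursion is on whether the first letter is used. -/
def lisFrom : List ℕ → ℕ → ℕ
  | [], _ => 0
  | s :: w, b => if b ≤ s then max (lisFrom w b) (lisFrom w (s + 1) + 1) else lisFrom w b

theorem lisFrom_le_cons (s : ℕ) (w : List ℕ) (b : ℕ) : lisFrom w b ≤ lisFrom (s :: w) b := by
  rw [lisFrom]
  split_ifs
  · exact le_max_left _ _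
  · exact le_rfl

theorem lisFrom_succ_lt_cons {s b : ℕ} (h : b ≤ s) (w : List ℕ) :
    lisFrom w (s + 1) + 1 ≤ lisFrom (s :: w) b := by
  rw [lisFrom, if_pos h]
  exact le_max_right _ _

theorem lisFrom_antitone (w : List ℕ) : Antitone (lisFrom w) := by
  induction w with
  | nil => intro a b _; simp [lisFrom]
  | cons s w ih =>
    intro a b hab
    by_cases hb : b ≤ s
    · simp only [lisFrom, if_pos hb, if_pos (hab.trans hb)]
      exact max_le_max (ih hab) le_rfl
    · rw [lisFrom, if_neg hb]
      exact (ih hab).trans (lisFrom_le_cons s w a)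

theorem lisFrom_eq_zero {w : List ℕ} {b : ℕ} (h : ∀ a ∈ w, a < b) : lisFrom w b = 0 := by
  induction w with
  | nil => rfl
  | cons s w ih =>
    rw [lisFrom, if_neg (not_le.2 (h s (by simp)))]
    exact ih fun a ha => h a (by simp [ha])

theorem length_le_lisFrom {l w : List ℕ} (hs : l.Sublist w) (hl : l.Pairwise (· < ·)) {b : ℕ}
    (hb : ∀ a ∈ l, b ≤ a) : l.length ≤ lisFrom w b := by
  induction hs generalizing b with
  | slnil => simp
  | cons a _ ih => exact (ih hl hb).trans (lisFrom_le_cons _ _ _)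
  | cons_cons a _ ih =>
    rw [List.pairwise_cons] at hl
    exact (Nat.succ_le_succ (ih hl.2 fun c hc => hl.1 c hc)).trans
      (lisFrom_succ_lt_cons (hb a (by simp)) _)

theorem exists_sublist_length_eq_lisFrom (w : List ℕ) (b : ℕ) :
    ∃ l : List ℕ, l.Sublist w ∧ l.Pairwise (· < ·) ∧ (∀ a ∈ l, b ≤ a) ∧
      l.length = lisFrom w b := by
  induction w generalizing b with
  | nil => exact ⟨[], by simp [lisFrom]⟩
  | cons s w ih =>
    obtain ⟨l, h1, h2, h3, h4⟩ := ih b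
    obtain ⟨l', h1', h2', h3', h4'⟩ := ih (s + 1)
    have hskip : ∃ l : List ℕ, l.Sublist (s :: w) ∧ l.Pairwise (· < ·) ∧ (∀ a ∈ l, b ≤ a) ∧
        l.length = lisFrom w b := ⟨l, h1.cons s, h2, h3, h4⟩
    by_cases hb : b ≤ s
    · rw [lisFrom, if_pos hb]
      rcases le_total (lisFrom w b) (lisFrom w (s + 1) + 1) with h | h
      · rw [max_eq_right h]
        refine ⟨s :: l', h1'.cons_cons s, List.pairwise_cons.2 ⟨fun a ha => h3' a ha, h2'⟩, ?_, ?_⟩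
        · intro a ha
          rcases List.mem_cons.1 ha with rfl | ha
          · exact hb
          · have := h3' a ha
            omega
        · simp [h4']
      · rw [max_eq_left h]
        exact hskip
    · rw [lisFrom, if_neg hb]
      exact hskip

theorem mem_increasingAvoiders_iff (m n : ℕ) (τ : Equiv.Perm (Fin n)) :
    (⟨n, τ⟩ : FinPerm) ∈ increasingAvoiders m ↔
      lisFrom (List.ofFn fun i => (τ i : ℕ)) 0 ≤ m := by
  constructor
  · intro h
    obtain ⟨l, h1, h2, -, h4⟩ := exists_sublist_length_eq_lisFrom (List.ofFn fun i => (τ i : ℕ)) 0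
    rw [← h4]
    obtain ⟨f, hf⟩ := List.sublist_iff_exists_fin_orderEmbedding_get_eq.1 h1
    refine h l.length ⟨fun i => Fin.cast List.length_ofFn (f i), ?_, ?_⟩
    · intro i j hij
      exact f.strictMono hij
    · intro i j hij
      have := List.pairwise_iff_get.1 h2 i j hij
      rw [hf, hf, List.get_ofFn, List.get_ofFn] at this
      exact this
  · rintro h k ⟨f, hf, hτ⟩
    refine le_trans ?_ h
    have := length_le_lisFrom (l := List.ofFn fun j => (τ (f j) : ℕ))
      (w := List.ofFn fun i => (τ i : ℕ)) (b := 0) ?_ ?_ (by simp)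
    · simpa using this
    · rw [List.sublist_iff_exists_fin_orderEmbedding_get_eq]
      refine ⟨OrderEmbedding.ofStrictMono
        (fun i => Fin.cast List.length_ofFn.symm (f (Fin.cast List.length_ofFn i))) ?_, ?_⟩
      · intro i j hij
        exact hf (show Fin.cast List.length_ofFn i < Fin.cast List.length_ofFn j from hij)
      · intro i
        simp
        rfl
    · rw [List.pairwise_ofFn]
      intro i j hij
      exact hτ hij

/-! ### Patience-sorting thresholds -/

/-- The left neighbour `z (j - 1)` of the threshold `z j`, with value `0` for `j = 0`. -/
def prevThreshold {m : ℕ} (z : Fin m → ℕ) (j : Fin m) : ℕ :=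
  if (j : ℕ) = 0 then 0 else z ⟨j - 1, by omega⟩

/-- The word `w` can be read from the thresholds `z`: if `z i` is one more than the smallest last
letter of an increasing subsequence of length `i + 1` read earlier, then appending `w` creates no
increasing subsequence with more than `m` terms. -/
def Admissible {m : ℕ} (z : Fin m → ℕ) (w : List ℕ) : Prop :=
  lisFrom w 0 ≤ m ∧ ∀ i : Fin m, lisFrom w (z i) + i + 1 ≤ m

theorem prevThreshold_le {m : ℕ} {z : Fin m → ℕ} (hz : Monotone z) (j : Fin m) :
    prevThreshold z j ≤ z j := by
  rw [prevThreshold]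
  split_ifs
  · exact Nat.zero_le _
  · exact hz (by simp [Fin.le_def])

theorem le_prevThreshold {m : ℕ} {z : Fin m → ℕ} (hz : Monotone z) {i j : Fin m} (h : i < j) :
    z i ≤ prevThreshold z j := by
  rw [Fin.lt_def] at h
  rw [prevThreshold, if_neg (by omega)]
  exact hz (by rw [Fin.le_def]; simp only; omega)

theorem monotone_update_threshold {m : ℕ} {z : Fin m → ℕ} (hz : Monotone z) {j : Fin m} {s : ℕ}
    (h1 : prevThreshold z j ≤ s) (h2 : s < z j) : Monotone (Function.update z j (s + 1)) := by
  intro a b hab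
  by_cases ha : a = j <;> by_cases hb : b = j
  · rw [ha, hb]
  · subst ha
    rw [Function.update_self, Function.update_of_ne hb]
    exact h2.trans_le (hz hab)
  · subst hb
    rw [Function.update_self, Function.update_of_ne ha]
    exact ((le_prevThreshold hz (lt_of_le_of_ne hab ha)).trans h1).trans (Nat.le_succ s)
  · rw [Function.update_of_ne ha, Function.update_of_ne hb]
    exact hz hab

theorem admissible_cons_iff {m : ℕ} {z : Fin m → ℕ} (hz : Monotone z) {j : Fin m} {s : ℕ}
    (h1 : prevThreshold z j ≤ s) (h2 : s < z j) (w : List ℕ) :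
    Admissible z (s :: w) ↔ Admissible (Function.update z j (s + 1)) w := by
  constructor
  · rintro ⟨h0, h⟩
    refine ⟨(lisFrom_le_cons s w 0).trans h0, fun i => ?_⟩
    rcases eq_or_ne i j with rfl | hi
    · rw [Function.update_self]
      rw [prevThreshold] at h1
      split_ifs at h1 with hi
      · have := lisFrom_succ_lt_cons (Nat.zero_le s) w
        omega
      · have := lisFrom_succ_lt_cons h1 w
        have := h ⟨i - 1, by omega⟩
        simp only at this
        omega
    · rw [Function.update_of_ne hi]
      have := lisFrom_le_cons s w (z i)
      have := h i
      omega
  · rintro ⟨h0, h⟩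
    have hj := h j
    rw [Function.update_self] at hj
    constructor
    · rw [lisFrom, if_pos (Nat.zero_le s)]
      exact max_le h0 (by omega)
    · intro i
      rw [lisFrom]
      split_ifs with hi
      · have hij : i < j := by
          by_contra hc
          have := hz (not_lt.1 hc)
          omega
        have := h i
        rw [Function.update_of_ne hij.ne] at this
        rw [Fin.lt_def] at hij
        omega
      · rcases eq_or_ne i j with rfl | hij
        · have := lisFrom_antitone w (show s + 1 ≤ z i by omega)
          omega
        · have := h i
          rwa [Function.update_of_ne hij] at this

open Classical in
/-- Reading a letter `s` replaces the unique threshold `z j` with `z (j - 1) ≤ s < z j`;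
if there is none, an increasing subsequence of length `m + 1` is completed. -/
theorem ite_admissible_cons {R : Type*} [AddCommMonoid R] {m : ℕ} {z : Fin m → ℕ}
    (hz : Monotone z) (s : ℕ) (w : List ℕ) (c : R) :
    (if Admissible z (s :: w) then c else 0) =
      ∑ j : Fin m, if prevThreshold z j ≤ s ∧ s < z j then
        (if Admissible (Function.update z j (s + 1)) w then c else 0) else 0 := by
  by_cases hs : ∃ j, s < z j
  · obtain ⟨j, hj, hmin⟩ : ∃ j, s < z j ∧ ∀ i < j, ¬ s < z i :=
      ⟨wellFounded_lt.min {j | s < z j} hs, wellFounded_lt.min_mem {j | s < z j} hs,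
        fun i hi h => wellFounded_lt.not_lt_min {j | s < z j} h hi⟩
    have hp : prevThreshold z j ≤ s := by
      rw [prevThreshold]
      split_ifs with h0
      · exact Nat.zero_le s
      · exact not_lt.1 (hmin _ (by rw [Fin.lt_def]; simp only; omega))
    rw [Finset.sum_eq_single j, if_pos (show prevThreshold z j ≤ s ∧ s < z j from ⟨hp, hj⟩)]
    · simp only [admissible_cons_iff hz hp hj]
    · intro i _ hij
      rw [if_neg]
      rintro ⟨ha, hb⟩
      rcases lt_or_gt_of_ne hij with h | h
      · exact hmin i h hb
      · have := le_prevThreshold hz h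
        omega
    · simp
  · push Not at hs
    rw [Finset.sum_eq_zero fun j _ => if_neg fun h => (hs j).not_gt h.2, if_neg]
    rintro ⟨h0, h⟩
    rcases Nat.eq_zero_or_pos m with rfl | hm
    · have := lisFrom_succ_lt_cons (Nat.zero_le s) w
      omega
    · have := h ⟨m - 1, by omega⟩
      have := lisFrom_succ_lt_cons (hs ⟨m - 1, by omega⟩) w
      simp only at *
      omega

open Classical in
/-- The weighted count of the words of length `n` in the letters `0, …, L - 1` that can be read
from the thresholds `z`, a letter `s` having weight `x s`. -/
noncomputable def wordSum {R : Type*} [CommRing R] (x : ℕ → R) (L : ℕ) {m : ℕ} (z : Fin m → ℕ)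
    (n : ℕ) : R :=
  ∑ w : Fin n → Fin L, if Admissible z (List.ofFn fun i => (w i : ℕ)) then ∏ i, x (w i) else 0

theorem wordSum_zero {R : Type*} [CommRing R] (x : ℕ → R) (L : ℕ) {m : ℕ} (z : Fin m → ℕ) :
    wordSum x L z 0 = 1 := by
  have : Admissible z [] := ⟨Nat.zero_le _, fun i => by rw [lisFrom]; omega⟩
  simp [wordSum, this]

theorem wordSum_succ {R : Type*} [CommRing R] (x : ℕ → R) (L : ℕ) {m : ℕ} {z : Fin m → ℕ}
    (hz : Monotone z) (hL : ∀ j, z j ≤ L) (n : ℕ) :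
    wordSum x L z (n + 1) = ∑ j, ∑ s ∈ Finset.Ico (prevThreshold z j) (z j),
      x s * wordSum x L (Function.update z j (s + 1)) n := by
  classical
  have hfirst : wordSum x L z (n + 1) = ∑ s : Fin L, ∑ j : Fin m,
      if prevThreshold z j ≤ s ∧ (s : ℕ) < z j then
        x s * wordSum x L (Function.update z j (s + 1)) n else 0 := by
    rw [wordSum, ← (Fin.consEquiv fun _ => Fin L).sum_comp, Fintype.sum_prod_type]
    refine Finset.sum_congr rfl fun s _ => ?_
    simp only [Fin.consEquiv_apply, List.ofFn_succ, Fin.cons_zero, Fin.cons_succ,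
      Fin.prod_univ_succ, ite_admissible_cons hz]
    rw [Finset.sum_comm]
    refine Finset.sum_congr rfl fun j _ => ?_
    split_ifs
    · rw [wordSum, Finset.mul_sum]
      refine Finset.sum_congr rfl fun w _ => ?_
      rw [mul_ite, mul_zero]
    · exact Finset.sum_const_zero
  rw [hfirst, Finset.sum_comm]
  refine Finset.sum_congr rfl fun j _ => ?_
  rw [Fin.sum_univ_eq_sum_range (fun s => if prevThreshold z j ≤ s ∧ s < z j then
        x s * wordSum x L (Function.update z j (s + 1)) n else 0) L, ← Finset.sum_filter]
  refine Finset.sum_congr ?_ fun _ _ => rfl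
  ext s
  have := hL j
  simp only [Finset.mem_filter, Finset.mem_range, Finset.mem_Ico]
  omega

/-! ### Derivatives and column expansions of determinants, squares equal to zero -/

theorem Derivation.leibniz_finset_prod {R A ι : Type*} [CommRing R] [CommRing A] [Algebra R A] [DecidableEq ι]
    (D : Derivation R A A) (s : Finset ι) (f : ι → A) :
    D (∏ i ∈ s, f i) = ∑ i ∈ s, ∏ j ∈ s, Function.update f i (D (f i)) j := by
  induction s using Finset.induction_on with
  | empty => simp
  | insert a s ha ih =>
    rw [Finset.prod_insert ha, D.leibniz, ih, Finset.sum_insert ha, Finset.prod_insert ha,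
      Function.update_self, smul_eq_mul, smul_eq_mul, Finset.mul_sum, add_comm, mul_comm]
    congr 1
    · congr 1
      refine Finset.prod_congr rfl fun j hj => ?_
      rw [Function.update_of_ne (ne_of_mem_of_not_mem hj ha)]
    · refine Finset.sum_congr rfl fun i hi => ?_
      rw [Finset.prod_insert ha, Function.update_of_ne (ne_of_mem_of_not_mem hi ha).symm]

theorem Derivation.map_det {R A ι : Type*} [CommRing R] [CommRing A] [Algebra R A] [DecidableEq ι] [Fintype ι]
    (D : Derivation R A A) (M : Matrix ι ι A) :
    D M.det = ∑ j, (M.updateCol j fun i => D (M i j)).det := by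
  simp only [Matrix.det_apply, map_sum, Units.smul_def, map_zsmul, Derivation.leibniz_finset_prod]
  rw [Finset.sum_comm]
  refine Finset.sum_congr rfl fun σ _ => ?_
  rw [Finset.smul_sum]
  refine Finset.sum_congr rfl fun j _ => ?_
  congr 1
  refine Finset.prod_congr rfl fun i _ => ?_
  rw [Matrix.updateCol_apply, Function.update_apply]
  split_ifs with h
  · rw [h]
  · rfl

theorem Matrix.det_updateCol_finset_sum {A ι κ : Type*} [CommRing A] [DecidableEq ι] [Fintype ι]
    (M : Matrix ι ι A) (j : ι) (s : Finset κ) (c : κ → A) (v : κ → ι → A) :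
    (M.updateCol j (∑ k ∈ s, c k • v k)).det = ∑ k ∈ s, c k * (M.updateCol j (v k)).det := by
  simp only [← Matrix.cramer_apply]
  simp only [map_sum, Finset.sum_apply, map_smul, Pi.smul_apply, smul_eq_mul]

theorem add_pow_succ_of_sq_eq_zero {R : Type*} [CommRing R] {x : R} (hx : x ^ 2 = 0) (e : R) (n : ℕ) :
    (e + x) ^ (n + 1) = e ^ (n + 1) + (n + 1) * (x * e ^ n) := by
  induction n with
  | zero => ring
  | succ n ih =>
    rw [pow_succ, ih]
    push_cast
    linear_combination ((n : R) + 1) * e ^ n * hx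

theorem mul_add_pow_of_sq_eq_zero {R : Type*} [CommRing R] {x : R} (hx : x ^ 2 = 0) (e : R) (n : ℕ) :
    x * (e + x) ^ n = x * e ^ n := by
  cases n with
  | zero => simp
  | succ n =>
    rw [add_pow_succ_of_sq_eq_zero hx]
    linear_combination ((n : R) + 1) * e ^ n * hx

/-! ### Bessel-type power series over a `ℚ`-algebra -/

section BesselSeries

variable {R : Type*} [CommRing R] [Algebra ℚ R]

/-- The divided power `e ^ r / r!` for `r : ℤ`, with value `0` for `r < 0`. -/
noncomputable def dividedPower (r : ℤ) (e : R) : R :=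
  if 0 ≤ r then (1 / (r.toNat ! : ℚ)) • e ^ r.toNat else 0

theorem dividedPower_natCast (n : ℕ) (e : R) :
    dividedPower (n : ℤ) e = (1 / (n ! : ℚ)) • e ^ n := by
  simp [dividedPower]

theorem dividedPower_of_neg {r : ℤ} (hr : r < 0) (e : R) : dividedPower r e = 0 :=
  if_neg (not_le.2 hr)

theorem dividedPower_zero (r : ℤ) : dividedPower r (0 : R) = if r = 0 then 1 else 0 := by
  rcases lt_or_ge r 0 with h | h
  · rw [dividedPower_of_neg h, if_neg h.ne]
  · lift r to ℕ using h
    rw [dividedPower_natCast]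
    rcases Nat.eq_zero_or_pos r with rfl | h
    · simp
    · simp [h.ne']

theorem dividedPower_add_sub {x : R} (hx : x ^ 2 = 0) (e : R) (r : ℤ) :
    dividedPower (r + 1) (e + x) - dividedPower (r + 1) e = x * dividedPower r (e + x) := by
  rcases lt_or_ge r 0 with h | h
  · rw [dividedPower_of_neg h, mul_zero]
    rcases (show r + 1 ≤ 0 by omega).lt_or_eq with h' | h'
    · rw [dividedPower_of_neg h', dividedPower_of_neg h', sub_zero]
    · rw [h']
      simp [dividedPower]
  · lift r to ℕ using h
    have h1 : (r : ℤ) + 1 = ((r + 1 : ℕ) : ℤ) := by push_cast; rfl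
    rw [h1, dividedPower_natCast, dividedPower_natCast, dividedPower_natCast, ← smul_sub,
      add_pow_succ_of_sq_eq_zero hx, mul_smul_comm, mul_add_pow_of_sq_eq_zero hx,
      add_sub_cancel_left, Nat.factorial_succ]
    have h2 : ((r : R) + 1) = algebraMap ℚ R (r + 1) := by simp
    rw [h2, ← Algebra.smul_def, smul_smul]
    congr 1
    have : (r ! : ℚ) ≠ 0 := by positivity
    push_cast
    field_simp

/-- The series `∑ₖ Tᵏ / k! · e ^ (k + r) / (k + r)!`. It is the modified Bessel function `besselI r`
with the powers `e ^ (k + r)` and `T ^ k` in place of `t ^ (2 k + r)`. -/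
noncomputable def besselSeries (r : ℤ) (e : R) : PowerSeries R :=
  PowerSeries.mk fun k => (1 / (k ! : ℚ)) • dividedPower (k + r) e

theorem derivative_besselSeries (r : ℤ) (e : R) :
    PowerSeries.derivative R (besselSeries r e) = besselSeries (r + 1) e := by
  ext k
  rw [PowerSeries.coeff_derivative, besselSeries, besselSeries, PowerSeries.coeff_mk,
    PowerSeries.coeff_mk, mul_comm]
  have h2 : ((k : R) + 1) = algebraMap ℚ R (k + 1) := by simp
  rw [h2, ← Algebra.smul_def, smul_smul, Nat.factorial_succ]
  congr 1
  · have : (k ! : ℚ) ≠ 0 := by positivity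
    push_cast
    field_simp
  · congr 1
    push_cast
    ring

theorem besselSeries_add_sub {x : R} (hx : x ^ 2 = 0) (e : R) (r : ℤ) :
    besselSeries (r + 1) (e + x) - besselSeries (r + 1) e =
      PowerSeries.C x * besselSeries r (e + x) := by
  ext k
  rw [map_sub, PowerSeries.coeff_C_mul, besselSeries, besselSeries, besselSeries,
    PowerSeries.coeff_mk, PowerSeries.coeff_mk, PowerSeries.coeff_mk, ← smul_sub, mul_smul_comm,
    ← add_assoc, dividedPower_add_sub hx]

theorem besselSeries_zero_of_pos {r : ℤ} (hr : 0 < r) : besselSeries r (0 : R) = 0 := by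
  ext k
  rw [besselSeries, PowerSeries.coeff_mk, dividedPower_zero, if_neg (by omega), smul_zero, map_zero]

theorem constantCoeff_besselSeries (r : ℤ) (e : R) :
    PowerSeries.constantCoeff (besselSeries r e) = dividedPower r e := by
  rw [← PowerSeries.coeff_zero_eq_constantCoeff_apply, besselSeries, PowerSeries.coeff_mk]
  simp

/-! ### The determinant as a function of the thresholds -/

/-- The matrix with entries `besselSeries (i - j) (∑_{s < z j} x s)`. -/
noncomputable def thresholdMatrix (x : ℕ → R) {m : ℕ} (z : Fin m → ℕ) :
    Matrix (Fin m) (Fin m) (PowerSeries R) :=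
  Matrix.of fun i j => besselSeries ((i : ℕ) - (j : ℕ)) (∑ s ∈ Finset.range (z j), x s)

theorem constantCoeff_det_thresholdMatrix (x : ℕ → R) {m : ℕ} (z : Fin m → ℕ) :
    PowerSeries.constantCoeff (thresholdMatrix x z).det = 1 := by
  rw [RingHom.map_det, Matrix.det_of_isLowerTriangular]
  · refine Finset.prod_eq_one fun i _ => ?_
    simp [thresholdMatrix, constantCoeff_besselSeries, dividedPower]
  · intro i j hij
    have : (i : ℕ) < j := hij
    simp only [thresholdMatrix, RingHom.mapMatrix_apply, Matrix.map_apply, Matrix.of_apply,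
      constantCoeff_besselSeries]
    exact dividedPower_of_neg (by omega) _

theorem thresholdMatrix_update (x : ℕ → R) {m : ℕ} (z : Fin m → ℕ) (j : Fin m) (y : ℕ) :
    thresholdMatrix x (Function.update z j y) = (thresholdMatrix x z).updateCol j
      fun i => besselSeries ((i : ℕ) - (j : ℕ)) (∑ s ∈ Finset.range y, x s) := by
  ext1 i k
  rw [Matrix.updateCol_apply, thresholdMatrix, Matrix.of_apply]
  split_ifs with h
  · rw [h, Function.update_self]
  · rw [Function.update_of_ne h]
    rfl

/-- The differential equation in `T` satisfied by the determinant. The right-hand side is the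
step of the letter-by-letter recursion for words. -/
theorem derivative_det_thresholdMatrix {x : ℕ → R} (hx : ∀ s, x s ^ 2 = 0) {m : ℕ}
    {z : Fin m → ℕ} (hz : Monotone z) :
    PowerSeries.derivative R (thresholdMatrix x z).det =
      ∑ j, ∑ s ∈ Finset.Ico (prevThreshold z j) (z j),
        PowerSeries.C (x s) * (thresholdMatrix x (Function.update z j (s + 1))).det := by
  rw [Derivation.map_det]
  refine Finset.sum_congr rfl fun j _ => ?_
  simp only [thresholdMatrix_update]
  rw [← Matrix.det_updateCol_finset_sum]
  set c : ℕ → Fin m → PowerSeries R := fun y i =>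
    besselSeries ((i : ℕ) - (j : ℕ) + 1) (∑ s ∈ Finset.range y, x s) with hc
  have htel : ∑ s ∈ Finset.Ico (prevThreshold z j) (z j), (PowerSeries.C (x s) •
      fun i : Fin m => besselSeries ((i : ℕ) - (j : ℕ)) (∑ s ∈ Finset.range (s + 1), x s)) =
      c (z j) - c (prevThreshold z j) := by
    rw [← Finset.sum_Ico_sub c (prevThreshold_le hz j)]
    refine Finset.sum_congr rfl fun s _ => ?_
    ext1 i
    simp only [hc, Pi.sub_apply, Pi.smul_apply, smul_eq_mul, Finset.sum_range_succ]
    exact (besselSeries_add_sub (hx s) _ _).symm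
  have hder : (fun i => PowerSeries.derivative R (thresholdMatrix x z i j)) = c (z j) := by
    ext1 i
    exact derivative_besselSeries _ _
  -- The lower end of the telescoping sum repeats column `j - 1`, or is zero if `j = 0`.
  have hlow : ((thresholdMatrix x z).updateCol j (c (prevThreshold z j))).det = 0 := by
    rcases Nat.eq_zero_or_pos (j : ℕ) with h0 | h0
    · refine Matrix.det_eq_zero_of_column_eq_zero j fun i => ?_
      rw [Matrix.updateCol_self, hc, prevThreshold, if_pos h0]
      simp only [Finset.range_zero, Finset.sum_empty]
      exact besselSeries_zero_of_pos (by omega)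
    · have hne : (⟨j - 1, by omega⟩ : Fin m) ≠ j := by
        rw [Ne, Fin.ext_iff]
        simp only
        omega
      rw [← Matrix.det_updateCol_eq_zero (M := thresholdMatrix x z) hne]
      congr 2
      ext1 i
      rw [hc, prevThreshold, if_neg h0.ne']
      simp only [thresholdMatrix, Matrix.of_apply]
      congr 1
      omega
  rw [htel, hder, sub_eq_add_neg, ← neg_one_smul (PowerSeries R) (c (prevThreshold z j)),
    Matrix.det_updateCol_add, Matrix.det_updateCol_smul, hlow, mul_zero, add_zero]

/-- The word sums and the determinant obey the same recursion, hence agree. -/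
theorem wordSum_eq_coeff_det {x : ℕ → R} (hx : ∀ s, x s ^ 2 = 0) (L : ℕ) {m : ℕ}
    (n : ℕ) {z : Fin m → ℕ} (hz : Monotone z) (hL : ∀ j, z j ≤ L) :
    wordSum x L z n = n ! * PowerSeries.coeff n (thresholdMatrix x z).det := by
  induction n generalizing z with
  | zero =>
    rw [wordSum_zero, PowerSeries.coeff_zero_eq_constantCoeff_apply,
      constantCoeff_det_thresholdMatrix]
    simp
  | succ n ih =>
    have hd := congrArg (PowerSeries.coeff n) (derivative_det_thresholdMatrix hx hz)
    rw [PowerSeries.coeff_derivative] at hd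
    rw [Nat.factorial_succ, Nat.cast_mul, mul_comm ((n + 1 : ℕ) : R), mul_assoc,
      mul_comm ((n + 1 : ℕ) : R), Nat.cast_succ, hd, wordSum_succ x L hz hL, map_sum,
      Finset.mul_sum]
    refine Finset.sum_congr rfl fun j _ => ?_
    rw [map_sum, Finset.mul_sum]
    refine Finset.sum_congr rfl fun s hs => ?_
    rw [Finset.mem_Ico] at hs
    rw [PowerSeries.coeff_C_mul, ih (monotone_update_threshold hz hs.1 hs.2)]
    · ring
    · intro i
      have := hL j
      rw [Function.update_apply]
      split_ifs
      · omega
      · exact hL i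

end BesselSeries

/-! ### Reduction of the constant-threshold determinant to modified Bessel functions -/

/-- The Toeplitz matrix with entries `besselSeries (i - j) e`. -/
noncomputable def besselMatrix {R : Type*} [CommRing R] [Algebra ℚ R] (m : ℕ) (e : R) :
    Matrix (Fin m) (Fin m) (PowerSeries R) :=
  Matrix.of fun i j => besselSeries ((i : ℕ) - (j : ℕ)) e

theorem map_dividedPower {R S : Type*} [CommRing R] [Algebra ℚ R] [CommRing S] [Algebra ℚ S]
    (f : R →ₐ[ℚ] S) (r : ℤ) (e : R) : f (dividedPower r e) = dividedPower r (f e) := by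
  rw [dividedPower, dividedPower]
  split_ifs
  · rw [map_smul, map_pow]
  · exact map_zero f

/-- Naturality in `R`, through which homogeneity is proved over the domain `ℚ[X]`. -/
theorem map_det_besselMatrix {R S : Type*} [CommRing R] [Algebra ℚ R] [CommRing S] [Algebra ℚ S]
    (f : R →ₐ[ℚ] S) (m : ℕ) (e : R) :
    PowerSeries.map (f : R →+* S) (besselMatrix m e).det = (besselMatrix m (f e)).det := by
  rw [RingHom.map_det]
  congr 1
  ext i j k
  simp only [besselMatrix, besselSeries, RingHom.mapMatrix_apply, Matrix.map_apply,
    Matrix.of_apply, PowerSeries.coeff_map, PowerSeries.coeff_mk, RingHom.coe_coe, map_smul,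
    map_dividedPower]

theorem dividedPower_eq_mul_pow {R : Type*} [CommRing R] [Algebra ℚ R] (e : R) {r : ℤ} {a b : ℕ}
    (h : r + a = b) : e ^ a * dividedPower r e = e ^ b * dividedPower r 1 := by
  rcases lt_or_ge r 0 with hr | hr
  · rw [dividedPower_of_neg hr, dividedPower_of_neg hr, mul_zero, mul_zero]
  · lift r to ℕ using hr
    obtain rfl : b = r + a := by omega
    rw [dividedPower_natCast, dividedPower_natCast, one_pow, mul_smul_comm, mul_smul_comm, mul_one,
      ← pow_add, add_comm]

/-- Two determinants agree if the matrices are conjugate by `diag (y ^ i)`, for `y` cancellable. -/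
theorem Matrix.det_eq_of_pow_mul_eq {A : Type*} [CommRing A] [IsDomain A] {m : ℕ} {y : A}
    (hy : y ≠ 0) (M N : Matrix (Fin m) (Fin m) A)
    (h : ∀ i j : Fin m, y ^ (j : ℕ) * M i j = y ^ (i : ℕ) * N i j) : M.det = N.det := by
  have h1 := Matrix.det_mul_row (fun j : Fin m => y ^ (j : ℕ)) M
  have h2 := Matrix.det_mul_column (fun j : Fin m => y ^ (j : ℕ)) N
  simp only [h] at h1
  rw [h1] at h2
  exact mul_left_cancel₀ (Finset.prod_ne_zero_iff.2 fun i _ => pow_ne_zero _ hy) h2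

/-- Over `ℚ[X]` the variable is cancellable, so conjugation by `diag (X ^ i)` is available. -/
theorem det_besselMatrix_polynomial_X (m : ℕ) :
    (besselMatrix m (Polynomial.X : Polynomial ℚ)).det =
      PowerSeries.rescale Polynomial.X (besselMatrix m (1 : Polynomial ℚ)).det := by
  rw [RingHom.map_det]
  refine Matrix.det_eq_of_pow_mul_eq (y := PowerSeries.C Polynomial.X)
    ((map_ne_zero_iff _ PowerSeries.C_injective).2 Polynomial.X_ne_zero) _ _ fun i j => ?_
  ext1 k
  rw [← map_pow, ← map_pow, PowerSeries.coeff_C_mul, PowerSeries.coeff_C_mul]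
  simp only [besselMatrix, besselSeries, RingHom.mapMatrix_apply, Matrix.map_apply,
    Matrix.of_apply, PowerSeries.coeff_rescale, PowerSeries.coeff_mk, mul_smul_comm]
  rw [← mul_assoc, ← pow_add,
    dividedPower_eq_mul_pow (b := (i : ℕ) + k) Polynomial.X (by push_cast; ring)]

/-- The determinant is homogeneous: `e` enters only through the product `T * e`. -/
theorem coeff_det_besselMatrix {R : Type*} [CommRing R] [Algebra ℚ R] (m : ℕ) (e : R) (n : ℕ) :
    PowerSeries.coeff n (besselMatrix m e).det =
      PowerSeries.coeff n (besselMatrix m (1 : ℚ)).det • e ^ n := by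
  have h1 : (besselMatrix m e).det = PowerSeries.map (Polynomial.aeval (R := ℚ) e : _ →+* R)
      (besselMatrix m (Polynomial.X : Polynomial ℚ)).det := by
    rw [map_det_besselMatrix, Polynomial.aeval_X]
  have h2 : (besselMatrix m (1 : Polynomial ℚ)).det =
      PowerSeries.map (Algebra.ofId ℚ (Polynomial ℚ) : ℚ →+* Polynomial ℚ)
        (besselMatrix m (1 : ℚ)).det := by
    rw [map_det_besselMatrix, map_one]
  rw [h1, det_besselMatrix_polynomial_X, h2, PowerSeries.coeff_map, PowerSeries.coeff_rescale,
    PowerSeries.coeff_map, RingHom.coe_coe, RingHom.coe_coe, map_mul, map_pow, Polynomial.aeval_X,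
    Algebra.ofId_apply, AlgHom.commutes, Algebra.smul_def, mul_comm]

theorem coeff_besselI {r : ℤ} {n k : ℕ} (h : (k : ℤ) = 2 * n + r) :
    PowerSeries.coeff k (besselI r) = (1 / (n ! : ℚ)) * dividedPower (n + r) 1 := by
  rw [besselI, PowerSeries.coeff_mk]
  rcases lt_or_ge ((n : ℤ) + r) 0 with hr | hr
  · rw [dividedPower_of_neg hr, mul_zero]
    refine Finset.sum_eq_zero fun p hp => ?_
    rw [Finset.mem_filter, Finset.HasAntidiagonal.mem_antidiagonal] at hp
    omega
  · obtain ⟨b, hb⟩ := Int.eq_ofNat_of_zero_le hr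
    rw [hb, Finset.sum_eq_single (n, b)]
    · rw [dividedPower_natCast, one_pow, smul_eq_mul, mul_one, one_div_mul_one_div]
    · rintro ⟨p, q⟩ hp hne
      rw [Finset.mem_filter, Finset.HasAntidiagonal.mem_antidiagonal] at hp
      simp only [ne_eq, Prod.mk.injEq] at hp hne
      omega
    · intro hp
      refine (hp ?_).elim
      rw [Finset.mem_filter, Finset.HasAntidiagonal.mem_antidiagonal]
      simp only
      omega

theorem coeff_besselI_eq_zero {r : ℤ} {k : ℕ} (h : ∀ n : ℕ, (k : ℤ) ≠ 2 * n + r) :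
    PowerSeries.coeff k (besselI r) = 0 := by
  rw [besselI, PowerSeries.coeff_mk]
  refine Finset.sum_eq_zero fun p hp => ?_
  rw [Finset.mem_filter, Finset.HasAntidiagonal.mem_antidiagonal] at hp
  have := h p.1
  omega

/-- Conjugating by `diag (t ^ i)` turns `besselI (i - j)` into `besselSeries (i - j) 1` at
`T = t ^ 2`. -/
theorem det_besselI (m : ℕ) :
    (Matrix.of fun i j : Fin m => besselI (((i : ℕ) : ℤ) - ((j : ℕ) : ℤ))).det =
      PowerSeries.expand 2 two_ne_zero (besselMatrix m (1 : ℚ)).det := by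
  rw [AlgHom.map_det]
  refine Matrix.det_eq_of_pow_mul_eq (y := PowerSeries.X) PowerSeries.X_ne_zero _ _ fun i j => ?_
  ext1 k
  simp only [PowerSeries.coeff_X_pow_mul', AlgHom.mapMatrix_apply, Matrix.map_apply,
    Matrix.of_apply, besselMatrix]
  by_cases hk : ∃ n, k = 2 * n + (i : ℕ)
  · obtain ⟨n, rfl⟩ := hk
    rw [if_pos (Nat.le_add_left _ _), Nat.add_sub_cancel, PowerSeries.coeff_expand_mul,
      besselSeries, PowerSeries.coeff_mk, smul_eq_mul]
    split_ifs with hj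
    · exact coeff_besselI (by omega)
    · rw [dividedPower_of_neg (by omega), mul_zero]
  · have h1 : ∀ n : ℕ, ((k - (j : ℕ) : ℕ) : ℤ) = 2 * n + (((i : ℕ) : ℤ) - ((j : ℕ) : ℤ)) →
        ¬ (j : ℕ) ≤ k := fun n hn hj => hk ⟨n, by omega⟩
    rw [ite_eq_right_iff.2 fun hj => coeff_besselI_eq_zero fun n hn => h1 n hn hj,
      ite_eq_right_iff.2 fun hi => PowerSeries.coeff_expand_of_not_dvd _ _ _ ?_]
    rintro ⟨n, hn⟩
    exact hk ⟨n, by omega⟩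

/-! ### Extraction of the squarefree monomial -/

/-- The polynomial ring over `ℚ` in variables `X 0, X 1, …`, modulo the squares of the
variables. -/
abbrev SquareZeroRing : Type :=
  MvPolynomial ℕ ℚ ⧸ Ideal.span ((fun s => MvPolynomial.monomial s (1 : ℚ)) ''
    Set.range fun i : ℕ => Finsupp.single i 2)

/-- The class of the variable `X i`. -/
noncomputable def squareZeroVar (i : ℕ) : SquareZeroRing :=
  Ideal.Quotient.mk _ (MvPolynomial.X i)

theorem squareZeroVar_sq (i : ℕ) : squareZeroVar i ^ 2 = 0 := by
  rw [squareZeroVar, ← map_pow, Ideal.Quotient.eq_zero_iff_mem, MvPolynomial.X_pow_eq_monomial]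
  exact Ideal.subset_span ⟨_, ⟨i, rfl⟩, rfl⟩

theorem prod_squareZeroVar_ne_zero (n : ℕ) : ∏ i ∈ Finset.range n, squareZeroVar i ≠ 0 := by
  have hmon : ∏ i ∈ Finset.range n, (MvPolynomial.X i : MvPolynomial ℕ ℚ) =
      MvPolynomial.monomial (∑ i ∈ Finset.range n, Finsupp.single i 1) 1 := by
    rw [MvPolynomial.monomial_sum_one]
    rfl
  simp only [squareZeroVar]
  rw [← map_prod, Ne, Ideal.Quotient.eq_zero_iff_mem, hmon,
    MvPolynomial.mem_ideal_span_monomial_image]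
  intro h
  obtain ⟨-, ⟨i, rfl⟩, hi⟩ := h (∑ i ∈ Finset.range n, Finsupp.single i 1) (by
    rw [MvPolynomial.support_monomial, if_neg one_ne_zero]
    exact Finset.mem_singleton_self _)
  have h2 := hi i
  rw [Finsupp.single_eq_same, Finsupp.finsetSum_apply] at h2
  simp only [Finsupp.single_apply, Finset.sum_ite_eq', Finset.mem_range] at h2
  split_ifs at h2 <;> omega

theorem sum_range_pow_of_sq_eq_zero {R : Type*} [CommRing R] {x : ℕ → R} (hx : ∀ s, x s ^ 2 = 0)
    (n : ℕ) : (∑ s ∈ Finset.range n, x s) ^ n = n ! * ∏ s ∈ Finset.range n, x s ∧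
      (∑ s ∈ Finset.range n, x s) ^ (n + 1) = 0 := by
  induction n with
  | zero => simp
  | succ n ih =>
    rw [Finset.sum_range_succ, add_pow_succ_of_sq_eq_zero (hx n), add_pow_succ_of_sq_eq_zero (hx n),
      pow_succ _ (n + 1), ih.1, ih.2, Finset.prod_range_succ, Nat.factorial_succ]
    constructor
    · push_cast
      ring
    · simp

/-- In square-zero weights only the words without repeated letters survive, and those of length `n`
in `n` letters are the permutations. -/
theorem wordSum_eq_card {R : Type*} [CommRing R] {x : ℕ → R} (hx : ∀ s, x s ^ 2 = 0) (m n : ℕ) :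
    wordSum x n (fun _ : Fin m => n) n =
      (Nat.card {τ : Equiv.Perm (Fin n) // (⟨n, τ⟩ : FinPerm) ∈ increasingAvoiders m} : R) *
        ∏ s ∈ Finset.range n, x s := by
  classical
  have hadm : ∀ w : Fin n → Fin n, Admissible (fun _ : Fin m => n) (List.ofFn fun i => (w i : ℕ)) ↔
      lisFrom (List.ofFn fun i => (w i : ℕ)) 0 ≤ m := by
    refine fun w => ⟨fun h => h.1, fun h => ⟨h, fun i => ?_⟩⟩
    rw [lisFrom_eq_zero]
    · omega
    · simp [List.mem_ofFn]
  have hperm : wordSum x n (fun _ : Fin m => n) n = ∑ τ : Equiv.Perm (Fin n),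
      if (⟨n, τ⟩ : FinPerm) ∈ increasingAvoiders m then ∏ s ∈ Finset.range n, x s else 0 := by
    rw [wordSum]
    symm
    refine Finset.sum_of_injOn (fun τ => ⇑τ) (fun _ _ _ _ h => DFunLike.coe_injective h)
      (fun _ _ => Finset.mem_coe.2 (Finset.mem_univ _)) ?_ ?_
    · intro w _ hw
      have hinj : ¬ Function.Injective w := fun h => hw
        ⟨Equiv.ofBijective w (Finite.injective_iff_bijective.1 h), by simp, rfl⟩
      simp only [Function.Injective, not_forall] at hinj
      obtain ⟨a, b, hab, hne⟩ := hinj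
      rw [ite_eq_right_iff]
      intro _
      rw [← Finset.mul_prod_erase _ _ (Finset.mem_univ a),
        ← Finset.mul_prod_erase _ _ (Finset.mem_erase.2 ⟨Ne.symm hne, Finset.mem_univ b⟩), hab,
        ← mul_assoc, ← sq, hx, zero_mul]
    · intro τ _
      simp only [hadm, mem_increasingAvoiders_iff]
      rw [Equiv.prod_comp τ (fun i : Fin n => x i), Fin.prod_univ_eq_prod_range]
  rw [hperm, Finset.sum_ite, Finset.sum_const_zero, add_zero, Finset.sum_const, nsmul_eq_mul,
    Nat.card_eq_fintype_card, Fintype.card_subtype]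

theorem coeff_det_besselMatrix_one_of_prod_ne_zero {R : Type*} [CommRing R] [Algebra ℚ R]
    {x : ℕ → R} (hx : ∀ s, x s ^ 2 = 0) (m : ℕ) {n : ℕ}
    (hprod : ∏ s ∈ Finset.range n, x s ≠ 0) :
    PowerSeries.coeff n (besselMatrix m (1 : ℚ)).det =
      Nat.card {τ : Equiv.Perm (Fin n) // (⟨n, τ⟩ : FinPerm) ∈ increasingAvoiders m} *
        (1 / (n ! : ℚ) ^ 2) := by
  have h := wordSum_eq_coeff_det hx n n (z := fun _ : Fin m => n) monotone_const fun _ => le_rfl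
  have hM : thresholdMatrix x (fun _ : Fin m => n) =
      besselMatrix m (∑ s ∈ Finset.range n, x s) := rfl
  rw [hM, coeff_det_besselMatrix, (sum_range_pow_of_sq_eq_zero hx n).1, wordSum_eq_card hx] at h
  set c := PowerSeries.coeff n (besselMatrix m (1 : ℚ)).det
  set N := Nat.card {τ : Equiv.Perm (Fin n) // (⟨n, τ⟩ : FinPerm) ∈ increasingAvoiders m}
  have h2 : (N : ℚ) • ∏ s ∈ Finset.range n, x s =
      ((n ! : ℚ) * (c * n !)) • ∏ s ∈ Finset.range n, x s := by
    simp only [Algebra.smul_def, map_mul, map_natCast] at h ⊢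
    rw [h]
    ring
  have h3 := smul_left_injective ℚ hprod h2
  have : (n ! : ℚ) ≠ 0 := by positivity
  rw [h3]
  field_simp

theorem theorem1 (m : ℕ) (hm : 1 ≤ m) :
    HasSum
      (fun τ : increasingAvoiders m =>
        PowerSeries.monomial (2 * (τ : FinPerm).length)
          (1 / (((τ : FinPerm).length ! : ℚ) ^ 2)))
      (Matrix.det (Matrix.of fun i j : Fin m =>
        besselI (((i : ℕ) : ℤ) - ((j : ℕ) : ℤ)))) := by
  classical
  rw [det_besselI, PowerSeries.WithPiTopology.hasSum_iff_hasSum_coeff]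
  intro k
  by_cases hk : ∃ n, k = 2 * n
  · obtain ⟨n, rfl⟩ := hk
    rw [PowerSeries.coeff_expand_mul, coeff_det_besselMatrix_one_of_prod_ne_zero
      squareZeroVar_sq m (prod_squareZeroVar_ne_zero n)]
    let f : {τ : Equiv.Perm (Fin n) // (⟨n, τ⟩ : FinPerm) ∈ increasingAvoiders m} →
      increasingAvoiders m := fun τ => ⟨⟨n, τ.1⟩, τ.2⟩
    have hf : Function.Injective f := by
      rintro ⟨τ, _⟩ ⟨τ', _⟩ h
      simpa [f] using h
    rw [← hf.hasSum_iff]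
    · convert hasSum_fintype _ using 1
      · simp [f, FinPerm.length, PowerSeries.coeff_monomial, Nat.card_eq_fintype_card]
      · infer_instance
    · rintro ⟨⟨n', τ⟩, hτ⟩ hnot
      rw [PowerSeries.coeff_monomial, if_neg]
      intro h
      obtain rfl : n = n' := by
        change 2 * n = 2 * n' at h
        omega
      exact hnot ⟨⟨τ, hτ⟩, rfl⟩
  · rw [PowerSeries.coeff_expand_of_not_dvd _ _ _ fun h => hk h]
    convert hasSum_zero with τ
    rw [PowerSeries.coeff_monomial, if_neg fun h => hk ⟨_, h⟩]
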